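/- All rings are commutative with $1\neq 0$ and ring homomorphisms are unital. A minimal ring homomorphism is an injective, non-surjective ring homomorphism $f:R\hookrightarrow T$ such that, identifying $R$ with $f(R)$, there is no ring $S$ with $R\subsetneq S\subsetneq T$. For a ring extension $A\subseteq B$ let $(A:B)=\{b\in B : bB\subseteq A\}$ be its conductor, an ideal of $A$. For a maximal ideal $J$ of $R$ let $T_J$ be the localization of $T$ at the multiplicative set $R\setminus J$; the ideal $J$ is called crucial for $f$ if the canonical homomorphism $R_J\to T_J$ is not an isomorphism (for a minimal ring homomorphism there is exactly one such $J$). Let $f:R\hookrightarrow T$ be a minimal ring homomorphism that is a flat epimorphism of rings, with crucial maximal ideal $J$. Then $R_J/(R_J:T_J)$ is a local domain of Krull dimension one, and $T_J=R_{(R:T)}$; that is, $(R:T)$ is a prime ideal of $R$ and $T_J$ is isomorphic, as an $R$-algebra, to the localization of $R$ at $(R:T)$. -/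

import Mathlib

/-- The ring homomorphism `R → T` is minimal: it is injective and its image is a maximal proper
subring of `T`, i.e. it is not surjective and no ring lies strictly between `R` and `T`. -/
def IsMinimalRingHom (R T : Type*) [CommRing R] [CommRing T] [Algebra R T] : Prop :=
  Function.Injective (algebraMap R T) ∧ IsCoatom (algebraMap R T).range

/-- The conductor `(A : B)` of a ring extension `A ⊆ B`, as an ideal of `A`. (An element `b` of `B`
with `b B ⊆ A` is automatically in `A`, as `b = b * 1`.) -/
def extensionConductor (A B : Type*) [CommRing A] [CommRing B] [Algebra A B] : Ideal A where
  carrier := {a | ∀ b : B, algebraMap A B a * b ∈ (algebraMap A B).range}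
  zero_mem' b := by simp
  add_mem' hx hy b := by
    rw [map_add, add_mul]
    exact add_mem (hx b) (hy b)
  smul_mem' c x hx b := by
    rw [smul_eq_mul, map_mul, mul_assoc]
    exact mul_mem ⟨c, rfl⟩ (hx b)

/-- `T_J`, the localization of the `R`-algebra `T` at (the image of) the multiplicative set
`R \ J`. It is an algebra over `R_J = Localization.AtPrime J` in the canonical way. -/
abbrev LocalizedAt {R : Type*} (T : Type*) [CommRing R] [CommRing T] [Algebra R T]
    (J : Ideal R) [J.IsPrime] : Type _ :=
  Localization (Algebra.algebraMapSubmonoid T J.primeCompl)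

/-- The maximal ideal `J` of `R` is crucial for `R → T`: the canonical map `R_J → T_J` is not an
isomorphism. -/
def IsCrucialMaximalIdeal {R : Type*} (T : Type*) [CommRing R] [CommRing T] [Algebra R T]
    (J : Ideal R) [J.IsMaximal] : Prop :=
  ¬ Function.Bijective (algebraMap (Localization.AtPrime J) (LocalizedAt T J))

/-!
Localizing at `J` preserves all hypotheses, and the conductor of `R → T` is the contraction of that
of `R_J → T_J`. So let `A → B` be a minimal flat epimorphism, `A` local with maximal ideal `m`. If
`mB ≠ B`, then `B` would be faithfully flat over `A`, and a faithfully flat epimorphism is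
surjective; hence `mB = B`. Let `P = (A : B)`. If `a ∉ P`, then `aB ⊄ A`, so `A + aB = B` by
minimality and `B / aB` is a quotient of `A` in which `m` generates the unit ideal; it is therefore
zero, and `a` is a unit of `B`. Thus `A \ P` consists of the elements that become units in `B`, so
`P` is prime. For any `s ∈ m \ P` minimality gives `B = A[1/s]`, which is therefore `A_P`; every
`a ∉ P`, being a unit of `A[1/s]`, divides a power of `s`, so no prime lies strictly between `P`
and `m`.
-/

open Function IsLocalRing TensorProduct

section Epimorphisms

variable {R T : Type*} [CommRing R] [CommRing T] [Algebra R T]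

theorem algHom_ext_of_isEpi {C : Type*} [CommRing C] [Algebra R C] [Algebra.IsEpi R T]
    (f g : T →ₐ[R] C) : f = g := by
  ext t
  simpa using congr(Algebra.TensorProduct.lift f g (fun _ _ ↦ .all _ _)
    $(Algebra.tmul_comm R t (1 : T)))

variable (R T) in
theorem isEpi_of_isPushout {R' T' : Type*} [CommRing R'] [CommRing T'] [Algebra R R']
    [Algebra T T'] [Algebra R' T'] [Algebra R T'] [IsScalarTower R R' T'] [IsScalarTower R T T']
    [Algebra.IsPushout R T R' T'] [Algebra.IsEpi R T] : Algebra.IsEpi R' T' := by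
  let inl : T' →ₐ[R'] T' ⊗[R'] T' := Algebra.TensorProduct.includeLeft
  let inr : T' →ₐ[R'] T' ⊗[R'] T' := Algebra.TensorProduct.includeRight
  have h : inl.restrictScalars R = inr.restrictScalars R :=
    Algebra.IsPushout.algHom_ext (S := T) (R' := R') T'
      (AlgHom.ext fun r ↦ (inl.commutes r).trans (inr.commutes r).symm) (algHom_ext_of_isEpi _ _)
  exact (Algebra.isEpi_iff_forall_one_tmul_eq R' T').mpr fun x ↦ congr($h x).symm

theorem surjective_algebraMap_of_isEpi_of_faithfullyFlat [Algebra.IsEpi R T]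
    [Module.FaithfullyFlat R T] : Surjective (algebraMap R T) :=
  Module.FaithfullyFlat.surjective_of_tensorProduct (S := T) fun x ↦
    ⟨TensorProduct.lift (LinearMap.mul R T) x, Algebra.IsEpi.injective_lift_mul (by simp)⟩

theorem map_maximalIdeal_eq_top_of_flat_of_isEpi [IsLocalRing R] [Module.Flat R T]
    [Algebra.IsEpi R T] (h : ¬ Surjective (algebraMap R T)) :
    (maximalIdeal R).map (algebraMap R T) = ⊤ := by
  by_contra hne
  have : Module.FaithfullyFlat R T := by
    refine ⟨fun m hm htop ↦ hne ?_⟩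
    rwa [eq_maximalIdeal hm, Ideal.smul_top_eq_map, Submodule.restrictScalars_eq_top_iff] at htop
  exact h surjective_algebraMap_of_isEpi_of_faithfullyFlat

end Epimorphisms

section LocalRing

variable {A : Type*} [CommRing A] [IsLocalRing A]

theorem subsingleton_of_surjective_of_map_maximalIdeal_eq_top {C : Type*} [CommRing C]
    {f : A →+* C} (hf : Surjective f) (htop : (maximalIdeal A).map f = ⊤) : Subsingleton C := by
  by_contra hC
  have : Nontrivial C := not_subsingleton_iff_nontrivial.mp hC
  have := IsLocalHom.of_surjective f hf
  have := IsLocalRing.of_surjective' f hf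
  exact (maximalIdeal.isMaximal C).ne_top (top_le_iff.mp (htop ▸ map_maximalIdeal_le f))

theorem ringKrullDim_quotient_eq_one {P : Ideal A} [P.IsPrime] (hP : P ≠ maximalIdeal A)
    (h : ∀ a ∉ P, maximalIdeal A ≤ (P ⊔ Ideal.span {a}).radical) : ringKrullDim (A ⧸ P) = 1 := by
  have := IsLocalRing.of_surjective' _ (Ideal.Quotient.mk_surjective (I := P))
  refine ringKrullDim_eq_one_iff_of_isLocalRing_isDomain.mpr
    ⟨fun hfield ↦ hP (eq_maximalIdeal (Ideal.Quotient.maximal_of_isField P hfield)),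
      fun x hx y hy ↦ ?_⟩
  obtain ⟨a, rfl⟩ := Ideal.Quotient.mk_surjective x
  obtain ⟨s, rfl⟩ := Ideal.Quotient.mk_surjective y
  have hs : s ∈ maximalIdeal A := fun hu ↦ hy (hu.map _)
  obtain ⟨n, hn⟩ := h a (mt Ideal.Quotient.eq_zero_iff_mem.mpr hx) hs
  refine ⟨n, ?_⟩
  have hmap := Ideal.mem_map_of_mem (Ideal.Quotient.mk P) hn
  rwa [Ideal.map_sup, Ideal.map_quotient_self, bot_sup_eq, Ideal.map_span,
    Set.image_singleton, map_pow] at hmap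

end LocalRing

section Localization

variable {R T R' T' : Type*} [CommRing R] [CommRing T] [CommRing R'] [CommRing T'] [Algebra R T]
  [Algebra R R'] [Algebra T T'] [Algebra R' T'] [Algebra R T'] [IsScalarTower R R' T']
  [IsScalarTower R T T'] (M : Submonoid R)

theorem smul_mem_subring_iff [IsLocalization M R'] {S : Subring T'}
    (hS : (algebraMap R' T').range ≤ S) {u : M} {x : T'} : u • x ∈ S ↔ x ∈ S := by
  obtain ⟨v, hv⟩ := IsLocalization.map_units R' u
  have huv : u • x = algebraMap R' T' v * x := by
    rw [hv, ← IsScalarTower.algebraMap_apply, ← Algebra.smul_def, Submonoid.smul_def]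
  refine ⟨fun hx ↦ ?_, fun hx ↦ huv ▸ mul_mem (hS ⟨v, rfl⟩) hx⟩
  simpa [huv, ← mul_assoc, ← map_mul] using mul_mem (hS ⟨↑v⁻¹, rfl⟩) hx

theorem range_algebraMap_le_comap {S : Subring T'} (hS : (algebraMap R' T').range ≤ S) :
    (algebraMap R T).range ≤ S.comap (algebraMap T T') := by
  rintro _ ⟨r, rfl⟩
  rw [Subring.mem_comap, ← IsScalarTower.algebraMap_apply, IsScalarTower.algebraMap_apply R R']
  exact hS ⟨_, rfl⟩

variable [IsLocalization M R'] [IsLocalization (Algebra.algebraMapSubmonoid T M) T']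

theorem exists_smul_eq_algebraMap (x : T') : ∃ (u : M) (t : T), u • x = algebraMap T T' t := by
  obtain ⟨⟨t, u⟩, h⟩ := IsLocalizedModule.surj M (IsScalarTower.toAlgHom R T T').toLinearMap x
  exact ⟨u, t, h⟩

include M in
theorem subring_le_of_comap_le {S S' : Subring T'} (hS : (algebraMap R' T').range ≤ S)
    (hS' : (algebraMap R' T').range ≤ S')
    (h : S.comap (algebraMap T T') ≤ S'.comap (algebraMap T T')) : S ≤ S' := by
  intro x hx
  obtain ⟨u, t, ht⟩ := exists_smul_eq_algebraMap (T := T) M x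
  have htS : algebraMap T T' t ∈ S := ht ▸ (smul_mem_subring_iff M hS).mpr hx
  have htS' : algebraMap T T' t ∈ S' := h htS
  exact (smul_mem_subring_iff M hS').mp (ht ▸ htS')

include M in
theorem injective_algebraMap_of_isLocalization (h : Injective (algebraMap R T)) :
    Injective (algebraMap R' T') := by
  have : IsLocalization (M.map (algebraMap R T)) T' := ‹_›
  rw [IsLocalization.algebraMap_eq_map_map_submonoid M T R' T']
  exact IsLocalization.map_injective_of_injective M R' T' h

end Localization

namespace extensionConductor

variable {A B : Type*} [CommRing A] [CommRing B] [Algebra A B]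

theorem mul_mem_range_of_mem_map {x : B}
    (hx : x ∈ (extensionConductor A B).map (algebraMap A B)) (b : B) :
    x * b ∈ (algebraMap A B).range := by
  induction hx using Submodule.span_induction generalizing b with
  | mem _ hx =>
    obtain ⟨a, ha, rfl⟩ := hx
    exact ha b
  | zero => simp only [zero_mul, zero_mem]
  | add x y _ _ hx hy => exact add_mul x y b ▸ add_mem (hx b) (hy b)
  | smul c x _ hx =>
    rw [smul_eq_mul, mul_comm c, mul_assoc]
    exact hx (c * b)

theorem map_ne_top (h : ¬ Surjective (algebraMap A B)) :
    (extensionConductor A B).map (algebraMap A B) ≠ ⊤ := fun htop ↦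
  h fun b ↦ by simpa using mul_mem_range_of_mem_map (htop ▸ Submodule.mem_top : (1 : B) ∈ _) b

end extensionConductor

namespace IsMinimalRingHom

section Conductor

variable {A B : Type*} [CommRing A] [CommRing B] [Algebra A B]

theorem not_surjective (h : IsMinimalRingHom A B) : ¬ Surjective (algebraMap A B) :=
  fun hs ↦ h.2.1 (RingHom.range_eq_top.mpr hs)

theorem surjective_quotient_or_subset_range (h : IsMinimalRingHom A B) (I : Ideal B) :
    Surjective (algebraMap A (B ⧸ I)) ∨ (I : Set B) ⊆ (algebraMap A B).range := by
  let S : Subring B := (algebraMap A (B ⧸ I)).range.comap (Ideal.Quotient.mk I)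
  have hS : (algebraMap A B).range ≤ S := by
    rintro _ ⟨a, rfl⟩
    exact ⟨a, rfl⟩
  refine (h.2.le_iff.mp hS).imp (fun htop y ↦ ?_) fun heq b hb ↦ ?_
  · obtain ⟨b, rfl⟩ := Ideal.Quotient.mk_surjective y
    exact (htop ▸ Subring.mem_top b : b ∈ S)
  · exact heq ▸ (⟨0, by rw [map_zero, Ideal.Quotient.eq_zero_iff_mem.mpr hb]⟩ : b ∈ S)

theorem isLocalization_away (h : IsMinimalRingHom A B) {s : A} (hs : ¬ IsUnit s)
    (hsB : IsUnit (algebraMap A B s)) : IsLocalization.Away s B := by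
  let φ : Localization.Away s →ₐ[A] B :=
    IsLocalization.Away.liftAlgHom s (f := Algebra.ofId A B) hsB
  have hinj : Injective φ :=
    (IsLocalization.injective_iff_map_algebraMap_eq (Submonoid.powers s) φ.toRingHom).mpr
      fun x y ↦ ⟨congrArg φ, fun hxy ↦ congrArg _ <| h.1 <|
        (φ.commutes x).symm.trans (hxy.trans (φ.commutes y))⟩
  have hle : (algebraMap A B).range ≤ φ.toRingHom.range := by
    rintro _ ⟨a, rfl⟩
    exact ⟨algebraMap A _ a, φ.commutes a⟩
  have hsurj : Surjective φ := by
    refine RingHom.range_eq_top.mp ((h.2.le_iff.mp hle).resolve_right fun heq ↦ ?_)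
    obtain ⟨c, hc⟩ : φ (IsLocalization.Away.invSelf s) ∈ (algebraMap A B).range := heq ▸ ⟨_, rfl⟩
    refine hs (.of_mul_eq_one c (h.1 ?_))
    rw [map_mul, hc, ← φ.commutes, ← map_mul, IsLocalization.Away.mul_invSelf, map_one, map_one]
  exact IsLocalization.isLocalization_of_algEquiv _ (AlgEquiv.ofBijective φ ⟨hinj, hsurj⟩)

variable [IsLocalRing A]

theorem notMem_conductor_iff_isUnit (h : IsMinimalRingHom A B)
    (htop : (maximalIdeal A).map (algebraMap A B) = ⊤) {a : A} :
    a ∉ extensionConductor A B ↔ IsUnit (algebraMap A B a) := by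
  refine ⟨fun ha ↦ ?_, fun hu ha ↦ extensionConductor.map_ne_top h.not_surjective
    (Ideal.eq_top_of_isUnit_mem _ (Ideal.mem_map_of_mem _ ha) hu)⟩
  rw [← Ideal.span_singleton_eq_top, ← Ideal.Quotient.subsingleton_iff]
  have hsurj : Surjective (algebraMap A (B ⧸ Ideal.span {algebraMap A B a})) :=
    (h.surjective_quotient_or_subset_range _).resolve_right fun hsub ↦
      ha fun b ↦ hsub (Ideal.mul_mem_right b _ (Ideal.mem_span_singleton_self _))
  refine subsingleton_of_surjective_of_map_maximalIdeal_eq_top hsurj ?_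
  rw [IsScalarTower.algebraMap_eq A B (B ⧸ Ideal.span {algebraMap A B a}), ← Ideal.map_map,
    htop, Ideal.map_top]

theorem isPrime_conductor (h : IsMinimalRingHom A B)
    (htop : (maximalIdeal A).map (algebraMap A B) = ⊤) : (extensionConductor A B).IsPrime where
  ne_top' heq := extensionConductor.map_ne_top h.not_surjective (heq ▸ Ideal.map_top _)
  mem_or_mem' {a b} hab := by
    contrapose! hab
    simp only [h.notMem_conductor_iff_isUnit htop, map_mul] at hab ⊢
    exact hab.1.mul hab.2

theorem conductor_lt_maximalIdeal (h : IsMinimalRingHom A B)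
    (htop : (maximalIdeal A).map (algebraMap A B) = ⊤) :
    extensionConductor A B < maximalIdeal A :=
  (le_maximalIdeal (h.isPrime_conductor htop).ne_top).lt_of_ne fun heq ↦
    extensionConductor.map_ne_top h.not_surjective (heq ▸ htop)

theorem isLocalization_away_of_notMem_conductor (h : IsMinimalRingHom A B)
    (htop : (maximalIdeal A).map (algebraMap A B) = ⊤) {s : A} (hs : s ∈ maximalIdeal A)
    (hsP : s ∉ extensionConductor A B) : IsLocalization.Away s B :=
  h.isLocalization_away hs ((h.notMem_conductor_iff_isUnit htop).mp hsP)

theorem isLocalization_atPrime_conductor (h : IsMinimalRingHom A B)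
    (htop : (maximalIdeal A).map (algebraMap A B) = ⊤) [(extensionConductor A B).IsPrime] :
    IsLocalization.AtPrime B (extensionConductor A B) := by
  obtain ⟨s, hs, hsP⟩ := SetLike.exists_of_lt (h.conductor_lt_maximalIdeal htop)
  have := h.isLocalization_away_of_notMem_conductor htop hs hsP
  exact IsLocalization.of_le (Submonoid.powers s) _ (Submonoid.powers_le.mpr hsP)
    fun _ ↦ (h.notMem_conductor_iff_isUnit htop).mp

theorem ringKrullDim_quotient_conductor (h : IsMinimalRingHom A B)
    (htop : (maximalIdeal A).map (algebraMap A B) = ⊤) :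
    ringKrullDim (A ⧸ extensionConductor A B) = 1 := by
  have := h.isPrime_conductor htop
  refine ringKrullDim_quotient_eq_one (h.conductor_lt_maximalIdeal htop).ne fun a ha s hs ↦ ?_
  by_cases hsP : s ∈ extensionConductor A B
  · exact Ideal.le_radical (Ideal.mem_sup_left hsP)
  · have := h.isLocalization_away_of_notMem_conductor htop hs hsP
    obtain ⟨n, hn⟩ := (IsLocalization.Away.algebraMap_isUnit_iff (S := B) s).mp
      ((h.notMem_conductor_iff_isUnit htop).mp ha)
    exact ⟨n, Ideal.mem_sup_right (Ideal.mem_span_singleton.mpr hn)⟩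

end Conductor

section Localization

variable {R T R' T' : Type*} [CommRing R] [CommRing T] [CommRing R'] [CommRing T'] [Algebra R T]
  [Algebra R R'] [Algebra T T'] [Algebra R' T'] [Algebra R T'] [IsScalarTower R R' T']
  [IsScalarTower R T T'] (M : Submonoid R) [IsLocalization M R']
  [IsLocalization (Algebra.algebraMapSubmonoid T M) T']

include M

theorem of_isLocalization (h : IsMinimalRingHom R T) (hs : ¬ Surjective (algebraMap R' T')) :
    IsMinimalRingHom R' T' := by
  refine ⟨injective_algebraMap_of_isLocalization M h.1, mt RingHom.range_eq_top.mp hs,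
    fun S hS ↦ ?_⟩
  rcases h.2.le_iff.mp (range_algebraMap_le_comap hS.le) with htop | hbot
  · exact top_le_iff.mp (subring_le_of_comap_le M le_top hS.le (htop ▸ le_top))
  · exact absurd (subring_le_of_comap_le (T := T) M hS.le le_rfl
      (hbot.le.trans (range_algebraMap_le_comap le_rfl))) hS.not_ge

theorem comap_range_algebraMap (h : IsMinimalRingHom R T) (hs : ¬ Surjective (algebraMap R' T')) :
    (algebraMap R' T').range.comap (algebraMap T T') = (algebraMap R T).range :=
  (h.2.le_iff.mp (range_algebraMap_le_comap le_rfl)).resolve_left fun htop ↦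
    hs (RingHom.range_eq_top.mp (top_le_iff.mp
      (subring_le_of_comap_le M le_top le_rfl (htop ▸ le_top))))

theorem comap_conductor (h : IsMinimalRingHom R T) (hs : ¬ Surjective (algebraMap R' T')) :
    (extensionConductor R' T').comap (algebraMap R R') = extensionConductor R T := by
  ext r
  refine ⟨fun hr t ↦ ?_, fun hr x ↦ ?_⟩
  · rw [← h.comap_range_algebraMap M hs, Subring.mem_comap, map_mul,
      ← IsScalarTower.algebraMap_apply, IsScalarTower.algebraMap_apply R R']
    exact hr _
  · obtain ⟨u, t, ht⟩ := exists_smul_eq_algebraMap (T := T) M x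
    rw [← smul_mem_subring_iff M le_rfl (u := u), ← mul_smul_comm, ht,
      ← IsScalarTower.algebraMap_apply, IsScalarTower.algebraMap_apply R T T', ← map_mul]
    exact range_algebraMap_le_comap (T := T) le_rfl (hr t)

end Localization

end IsMinimalRingHom

theorem proposition3p5 {R T : Type*} [CommRing R] [CommRing T] [Algebra R T]
    (hmin : IsMinimalRingHom R T) (hflat : Module.Flat R T) (hepi : Algebra.IsEpi R T)
    (J : Ideal R) [J.IsMaximal] (hJ : IsCrucialMaximalIdeal T J) :
    (IsDomain (Localization.AtPrime J ⧸
        extensionConductor (Localization.AtPrime J) (LocalizedAt T J)) ∧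
      IsLocalRing (Localization.AtPrime J ⧸
        extensionConductor (Localization.AtPrime J) (LocalizedAt T J)) ∧
      ringKrullDim (Localization.AtPrime J ⧸
        extensionConductor (Localization.AtPrime J) (LocalizedAt T J)) = 1) ∧
    ∃ _ : (extensionConductor R T).IsPrime,
      Nonempty (LocalizedAt T J ≃ₐ[R] Localization.AtPrime (extensionConductor R T)) := by
  have hsurj : ¬ Surjective (algebraMap (Localization.AtPrime J) (LocalizedAt T J)) := fun hs ↦
    hJ ⟨injective_algebraMap_of_isLocalization J.primeCompl hmin.1, hs⟩
  have h : IsMinimalRingHom (Localization.AtPrime J) (LocalizedAt T J) :=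
    hmin.of_isLocalization J.primeCompl hsurj
  have : Module.Flat (Localization.AtPrime J) (LocalizedAt T J) :=
    (Module.flat_iff_of_isLocalization _ J.primeCompl _).mpr inferInstance
  have := Algebra.isPushout_of_isLocalization J.primeCompl (Localization.AtPrime J) T
    (LocalizedAt T J)
  have : Algebra.IsEpi (Localization.AtPrime J) (LocalizedAt T J) := isEpi_of_isPushout R T
  have htop := map_maximalIdeal_eq_top_of_flat_of_isEpi hsurj
  have hP := h.isPrime_conductor htop
  have := h.isLocalization_atPrime_conductor htop
  refine ⟨⟨inferInstance, .of_surjective' _ Ideal.Quotient.mk_surjective,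
    h.ringKrullDim_quotient_conductor htop⟩, ?_⟩
  have := IsLocalization.isLocalization_isLocalization_atPrime_isLocalization J.primeCompl
    (LocalizedAt T J) (extensionConductor (Localization.AtPrime J) (LocalizedAt T J))
  rw [← hmin.comap_conductor J.primeCompl hsurj]
  exact ⟨hP.comap _, ⟨.symm (Localization.algEquiv _ _)⟩⟩
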